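/- For every fixed integer $k\ge 4$, any randomized algorithm in the CONGEST model that decides whether the $n$-node network contains an induced cycle on $k$ vertices needs $\Omega(n/\log n)$ rounds. Here the network is an arbitrary simple undirected graph $G$ on $n$ nodes, which is also the input graph. Each node has a unique identifier of $\Theta(\log n)$ bits, and initially knows $n$, its own identifier, the identifiers of its neighbours, and random bits (private ones, independent for different nodes, and possibly also random bits shared by all nodes). In each synchronous round every node may perform unlimited local computation and send to each of its neighbours a possibly different message of $O(\log n)$ bits. An algorithm decides the problem in $r$ rounds if, for every $n$-node network and every assignment of unique identifiers, with probability at least $2/3$ the following holds: after $r$ rounds at least one node outputs $1$ if $G$ contains an induced $k$-cycle, and all nodes output $0$ otherwise. Precisely: for every $k\ge 4$ and every constant $C$ there are $c>0$ and $N$ such that for every $n\ge N$, every such algorithm for $n$-node networks with $b$-bit identifiers, where $2^b\ge n$ and $b\le C\log n$, and with messages of at most $w\le C\log n$ bits uses at least $c\,n/\log n$ rounds. -/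

import Mathlib

open MeasureTheory

namespace Congest

/-- Identifiers are bit strings of length `b`. -/
abbrev Ident (b : ℕ) : Type := Fin b → Bool

/-- Messages are bit strings of length at most `w`; the empty string may stand for silence. -/
abbrev Message (w : ℕ) : Type := {l : List Bool // l.length ≤ w}

/-- A randomized synchronous message-passing algorithm with `b`-bit identifiers and `w`-bit
messages, for networks with a fixed number `n` of nodes (so that all its components may depend on
`n`). All nodes run the same program, and local computation is unlimited: the maps below are
arbitrary. Every node draws a private random seed, independently of all the others; all nodes
moreover see one shared random seed (take `Shared := Unit` for an algorithm without shared
randomness). -/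
structure Algorithm (b w : ℕ) where
  /-- The probability space of the shared seed. -/
  Shared : Type
  [measurableSpaceShared : MeasurableSpace Shared]
  sharedLaw : Measure Shared
  [isProbabilityMeasure_sharedLaw : IsProbabilityMeasure sharedLaw]
  /-- The probability space from which each node draws its private seed. -/
  Private : Type
  [measurableSpacePrivate : MeasurableSpace Private]
  privateLaw : Measure Private
  [isProbabilityMeasure_privateLaw : IsProbabilityMeasure privateLaw]
  /-- The local states of a node. -/
  State : Type
  /-- The initial state of a node: a function of its own identifier, of the set of the identifiers
  of its neighbours, of the shared seed and of its private seed. -/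
  init : Ident b → Set (Ident b) → Shared → Private → State
  /-- The message that a node in the given state sends to its neighbour with the given
  identifier. -/
  send : State → Ident b → Message w
  /-- The new state of a node, given the messages of this round, each one together with the
  identifier of the neighbour who sent it. -/
  receive : State → Set (Ident b × Message w) → State
  /-- The output of a node in the given state. -/
  output : State → Bool

attribute [instance] Algorithm.measurableSpaceShared Algorithm.isProbabilityMeasure_sharedLaw
  Algorithm.measurableSpacePrivate Algorithm.isProbabilityMeasure_privateLaw

namespace Algorithm

variable {b w : ℕ} {V : Type}

/-- The state of each node after `t` rounds, in the network `G` with identifiers `ident`, shared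
seed `s` and private seeds `p`. -/
def stateAt (A : Algorithm b w) (G : SimpleGraph V) (ident : V ↪ Ident b)
    (s : A.Shared) (p : V → A.Private) : ℕ → V → A.State
  | 0, v => A.init (ident v) (ident '' G.neighborSet v) s (p v)
  | t + 1, v =>
      A.receive (A.stateAt G ident s p t v)
        {m | ∃ u, G.Adj v u ∧ m = (ident u, A.send (A.stateAt G ident s p t u) (ident v))}

/-- After `r` rounds at least one node outputs 1. -/
def Accepts (A : Algorithm b w) (r : ℕ) (G : SimpleGraph V) (ident : V ↪ Ident b)
    (s : A.Shared) (p : V → A.Private) : Prop :=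
  ∃ v, A.output (A.stateAt G ident s p r v) = true

/-- `A` decides the property `P` of `n`-node graphs within `r` rounds: on every `n`-node network
and for every assignment of distinct identifiers, the answer after `r` rounds (yes if at least one
node outputs 1, no if all nodes output 0) is wrong with probability at most `1/3`. -/
def Decides (A : Algorithm b w) (r n : ℕ) (P : SimpleGraph (Fin n) → Prop) : Prop :=
  ∀ (G : SimpleGraph (Fin n)) (ident : Fin n ↪ Ident b),
    (A.sharedLaw.prod (Measure.pi fun _ : Fin n => A.privateLaw))
      {ω | ¬ (A.Accepts r G ident ω.1 ω.2 ↔ P G)} ≤ 1 / 3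

end Algorithm

end Congest

/-! The proof reduces from two-party set disjointness. With `m = n / k`, the inputs are subsets `x`,
`y` of the `m ^ 2` pairs `(i, j)`. Vertices sit on `k` cyclically arranged levels and carry an
index. Consecutive levels are joined by matchings of equal indices, except at two places, where the
edges are given by `x` and by `y`. An intersection `(i, j)` gives an induced `k`-cycle visiting
every level once: index `i` on one half of the levels, `j` on the other. Conversely an induced
`k`-cycle has to wind once around the levels (`exists_inputs`), which exhibits an intersection. For
odd `k` this is parity; for even `k` the cycle could turn back, and two cliques, on the levels just
above the input edges, prevent this.

Cutting out the two levels adjacent to `x` severs only matching edges, `O(n)` of them. For fixed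
random seeds, the messages across the cut and the two sides' answers form a transcript with the
rectangle property (`transcript_rectangle`), whose number of values has logarithm `O(r * n * w)`.
Disjointness on `m ^ 2` elements needs this logarithm to be of order `m ^ 2` (`card_le_log_card`),
so `r * w` is at least of order `n`.

The disjointness bound is the information-cost argument with Hellinger distances, under a uniform
distribution on finite cubes. A map with `|T|` values can be sensitive to few coordinates of a
random disjoint pair (`sum_hellingerSq_update_le`), whereas cut-and-paste (`freq_planted_mul`)
forces sensitivity at every coordinate where a planted intersection is detected. -/

namespace SetDisjointness

/-! ### Frequencies and Hellinger distance -/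

open Finset Function

/-- The character of `Bool`. -/
def boolSign (b : Bool) : ℝ := if b then -1 else 1

/-- The fraction of the points of `Ω` at which `F` takes the value `τ`. -/
noncomputable def freq {Ω T : Type*} [Fintype Ω] [DecidableEq T] (F : Ω → T) (τ : T) : ℝ :=
  (#{z | F z = τ} : ℝ) / Fintype.card Ω

/-- The squared (unnormalised) Hellinger distance. -/
noncomputable def hellingerSq {T : Type*} [Fintype T] (p q : T → ℝ) : ℝ :=
  ∑ τ, (√(p τ) - √(q τ)) ^ 2

section Freq

variable {Ω T : Type*} [Fintype Ω] [DecidableEq T]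

theorem freq_nonneg (F : Ω → T) (τ : T) : 0 ≤ freq F τ := by
  unfold freq; positivity

theorem sum_freq_filter [Fintype T] (F : Ω → T) (p : T → Prop) [DecidablePred p] :
    ∑ τ with p τ, freq F τ = (#{z | p (F z)} : ℝ) / Fintype.card Ω := by
  unfold freq
  rw [← Finset.sum_div]
  congr 1
  norm_cast
  rw [Finset.card_eq_sum_card_fiberwise (f := F) (t := ({τ | p τ} : Finset T))]
  · refine Finset.sum_congr rfl fun τ hτ => ?_
    congr 1
    ext z
    simp only [mem_filter, mem_univ, true_and] at hτ ⊢
    constructor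
    · rintro rfl; exact ⟨hτ, rfl⟩
    · exact fun h => h.2
  · intro z hz
    simpa using hz

theorem sum_freq [Fintype T] [Nonempty Ω] (F : Ω → T) : ∑ τ, freq F τ = 1 := by
  have h := sum_freq_filter F (fun _ => True)
  simp only [filter_true] at h
  rw [h]
  simp

end Freq

section Hellinger

variable {T : Type*} [Fintype T]

theorem hellingerSq_le_two_mul_add (p q r : T → ℝ) :
    hellingerSq q r ≤ 2 * (hellingerSq p q + hellingerSq p r) := by
  unfold hellingerSq
  rw [← Finset.sum_add_distrib, Finset.mul_sum]
  refine Finset.sum_le_sum fun τ _ => ?_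
  nlinarith [sq_nonneg ((√(p τ) - √(q τ)) + (√(p τ) - √(r τ)))]

/-- For probability vectors the distance is `2 - 2 ∑ √(p q)`, so it depends only on the pointwise
product. This is the analytic half of cut-and-paste. -/
theorem hellingerSq_eq_of_mul_eq {p q r s : T → ℝ} (hp : ∀ τ, 0 ≤ p τ) (hq : ∀ τ, 0 ≤ q τ)
    (hr : ∀ τ, 0 ≤ r τ) (hs : ∀ τ, 0 ≤ s τ) (sp : ∑ τ, p τ = 1) (sq : ∑ τ, q τ = 1)
    (sr : ∑ τ, r τ = 1) (ss : ∑ τ, s τ = 1) (h : ∀ τ, p τ * q τ = r τ * s τ) :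
    hellingerSq p q = hellingerSq r s := by
  have key : ∀ {a b : T → ℝ}, (∀ τ, 0 ≤ a τ) → (∀ τ, 0 ≤ b τ) → ∑ τ, a τ = 1 → ∑ τ, b τ = 1 →
      hellingerSq a b = 2 - 2 * ∑ τ, √(a τ * b τ) := by
    intro a b ha hb sa sb
    have : ∀ τ, (√(a τ) - √(b τ)) ^ 2 = a τ + b τ - 2 * √(a τ * b τ) := fun τ => by
      rw [Real.sqrt_mul (ha τ), sub_sq, Real.sq_sqrt (ha τ), Real.sq_sqrt (hb τ)]
      ring
    unfold hellingerSq
    simp_rw [this]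
    rw [Finset.sum_sub_distrib, Finset.sum_add_distrib, sa, sb, ← Finset.mul_sum]
    norm_num
  rw [key hp hq sp sq, key hr hs sr ss]
  simp_rw [h]

theorem sum_sub_le_hellingerSq {p q : T → ℝ} (hp : ∀ τ, 0 ≤ p τ) (hq : ∀ τ, 0 ≤ q τ)
    (sp : ∑ τ, p τ = 1) (sq : ∑ τ, q τ = 1) (s : Finset T) :
    ∑ τ ∈ s, (q τ - p τ) ≤ 6 * hellingerSq p q + 1 / 6 := by
  -- AM-GM on `(√q - √p) * (√q + √p)`; the weight makes the additive loss sum to `1 / 6`, small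
  -- enough to leave a margin over error `1 / 3`.
  have h1 : ∀ τ, q τ - p τ ≤ 6 * (√(p τ) - √(q τ)) ^ 2 + (p τ + q τ) / 12 := fun τ => by
    have e1 := Real.sq_sqrt (hp τ)
    have e2 := Real.sq_sqrt (hq τ)
    nlinarith [sq_nonneg (12 * (√(p τ) - √(q τ)) + (√(p τ) + √(q τ))),
      sq_nonneg (√(p τ) - √(q τ))]
  calc ∑ τ ∈ s, (q τ - p τ) ≤ ∑ τ ∈ s, (6 * (√(p τ) - √(q τ)) ^ 2 + (p τ + q τ) / 12) :=
        Finset.sum_le_sum fun τ _ => h1 τ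
    _ ≤ ∑ τ, (6 * (√(p τ) - √(q τ)) ^ 2 + (p τ + q τ) / 12) := by
        refine Finset.sum_le_sum_of_subset_of_nonneg (Finset.subset_univ _) fun τ _ _ => ?_
        have := hp τ
        have := hq τ
        positivity
    _ = 6 * hellingerSq p q + 1 / 6 := by
        rw [Finset.sum_add_distrib, ← Finset.mul_sum, ← Finset.sum_div, Finset.sum_add_distrib,
          sp, sq]
        unfold hellingerSq
        norm_num

end Hellinger

/-! ### Influence of single coordinates on a map from the cube -/

section Cube

variable {J : Type*} [Fintype J] [DecidableEq J]

/-- Exponential tilting by the mean vector `a` of `S`, with `W = |a| ^ 2`: by convexity the average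
of `exp ⟨a, z⟩` over `S` is at least `exp W`, while its sum over the whole cube is `∏ 2 cosh (a j) ≤
2 ^ |J| * exp (W / 2)`. -/
theorem level_one_inequality (S : Finset (J → Bool)) (hS : S.Nonempty) :
    ∑ j, (∑ z ∈ S, boolSign (z j)) ^ 2 ≤
      2 * (#S : ℝ) ^ 2 * Real.log (2 ^ Fintype.card J / #S) := by
  have hs : (0 : ℝ) < #S := by exact_mod_cast hS.card_pos
  set a : J → ℝ := fun j => (∑ z ∈ S, boolSign (z j)) / #S with ha
  set W : ℝ := ∑ j, a j ^ 2 with hW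
  have hlin : ∑ z ∈ S, ∑ j, a j * boolSign (z j) = #S * W := by
    rw [Finset.sum_comm, hW, Finset.mul_sum]
    refine Finset.sum_congr rfl fun j _ => ?_
    rw [← Finset.mul_sum]
    simp only [ha]
    field_simp
  have hlow : #S * Real.exp W ≤ ∑ z ∈ S, Real.exp (∑ j, a j * boolSign (z j)) := by
    have h1 : ∀ t : ℝ, Real.exp W * (1 + t - W) ≤ Real.exp t := fun t => by
      have h2 := Real.add_one_le_exp (t - W)
      have h3 : Real.exp t = Real.exp W * Real.exp (t - W) := by
        rw [← Real.exp_add]; ring_nf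
      rw [h3]
      exact mul_le_mul_of_nonneg_left (by linarith) (Real.exp_pos _).le
    calc #S * Real.exp W
        = ∑ z ∈ S, Real.exp W * (1 + (∑ j, a j * boolSign (z j)) - W) := by
          rw [← Finset.mul_sum, Finset.sum_sub_distrib, Finset.sum_add_distrib, hlin]
          simp only [sum_const, nsmul_eq_mul, mul_one]
          ring
      _ ≤ _ := Finset.sum_le_sum fun z _ => h1 _
  have hup : ∑ z ∈ S, Real.exp (∑ j, a j * boolSign (z j)) ≤
      2 ^ Fintype.card J * Real.exp (W / 2) := by
    calc ∑ z ∈ S, Real.exp (∑ j, a j * boolSign (z j))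
        ≤ ∑ z : J → Bool, Real.exp (∑ j, a j * boolSign (z j)) :=
          Finset.sum_le_sum_of_subset_of_nonneg (Finset.subset_univ _)
            fun z _ _ => (Real.exp_pos _).le
      _ = ∏ j, ∑ b : Bool, Real.exp (a j * boolSign b) := by
          rw [Finset.prod_univ_sum, Fintype.piFinset_univ]
          simp only [Real.exp_sum]
      _ = ∏ j, (2 * Real.cosh (a j)) := by
          refine Finset.prod_congr rfl fun j _ => ?_
          rw [Real.cosh_eq]
          simp [boolSign]
          ring
      _ ≤ ∏ j, (2 * Real.exp (a j ^ 2 / 2)) := by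
          refine Finset.prod_le_prod (fun j _ => ?_) fun j _ => ?_
          · have := Real.cosh_pos (a j); positivity
          · have := Real.cosh_le_exp_half_sq (a j); linarith
      _ = _ := by
          rw [Finset.prod_mul_distrib, ← Real.exp_sum, ← Finset.sum_div, ← hW]
          simp
  have hWle : W ≤ 2 * Real.log (2 ^ Fintype.card J / #S) := by
    have h1 : Real.exp (W / 2) ≤ 2 ^ Fintype.card J / #S := by
      rw [le_div_iff₀ hs]
      have h2 := hlow.trans hup
      have h3 : Real.exp W = Real.exp (W / 2) * Real.exp (W / 2) := by
        rw [← Real.exp_add]; ring_nf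
      rw [h3] at h2
      have h4 := Real.exp_pos (W / 2)
      nlinarith
    have := (Real.le_log_iff_exp_le (by positivity)).2 h1
    linarith
  have hfin : ∑ j, (∑ z ∈ S, boolSign (z j)) ^ 2 = (#S : ℝ) ^ 2 * W := by
    rw [hW, Finset.mul_sum]
    refine Finset.sum_congr rfl fun j _ => ?_
    simp only [ha]
    field_simp
  rw [hfin]
  nlinarith [mul_le_mul_of_nonneg_left hWle (sq_nonneg (#S : ℝ))]

variable {T : Type*} [DecidableEq T]

theorem card_filter_update (F : (J → Bool) → T) (j : J) (b : Bool) (τ : T) :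
    #{z | F (update z j b) = τ} = 2 * #{z | F z = τ ∧ z j = b} := by
  have h1 : #{z | F (update z j b) = τ ∧ z j = b} = #{z | F z = τ ∧ z j = b} := by
    congr 1
    ext z
    simp only [mem_filter, mem_univ, true_and]
    constructor <;> rintro ⟨h, rfl⟩ <;> simpa using h
  have h2 : #{z | F (update z j b) = τ ∧ ¬ z j = b} = #{z | F z = τ ∧ z j = b} := by
    refine Finset.card_nbij' (fun z => update z j b) (fun z => update z j (!b)) ?_ ?_ ?_ ?_
    · intro z hz
      simp only [coe_filter, mem_univ, true_and, Set.mem_ofPred_eq] at hz ⊢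
      simpa using hz.1
    · intro z hz
      simp only [coe_filter, mem_univ, true_and, Set.mem_ofPred_eq] at hz ⊢
      rw [update_idem, ← hz.2]
      simpa using hz.1
    · intro z hz
      simp only [coe_filter, mem_univ, true_and, Set.mem_ofPred_eq] at hz
      have : z j = !b := by cases h : z j <;> cases b <;> simp_all
      simp [← this]
    · intro z hz
      simp only [coe_filter, mem_univ, true_and, Set.mem_ofPred_eq] at hz
      simp [← hz.2]
  have h3 := Finset.card_filter_add_card_filter_not (s := ({z | F (update z j b) = τ} :
    Finset (J → Bool))) (fun z => z j = b)
  rw [Finset.filter_filter, Finset.filter_filter, h1, h2] at h3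
  omega

/-- Replaces the chain rule for mutual information: overwriting a coordinate of a uniform point
amounts to conditioning on it, and each fibre of `F` obeys the level-one inequality. -/
theorem sum_hellingerSq_update_le [Fintype T] (F : (J → Bool) → T) :
    ∑ j, hellingerSq (freq fun z => F (update z j false)) (freq fun z => F (update z j true)) ≤
      4 * Real.log (Fintype.card T) := by
  set M : ℝ := 2 ^ Fintype.card J with hM
  have hMpos : 0 < M := by positivity
  have hcard : ((Fintype.card (J → Bool) : ℕ) : ℝ) = M := by simp [hM]
  have hT : (0 : ℝ) < Fintype.card T := by
    have : Nonempty T := ⟨F fun _ => false⟩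
    exact_mod_cast Fintype.card_pos
  have hstep : ∀ j τ, (√(freq (fun z => F (update z j false)) τ) -
      √(freq (fun z => F (update z j true)) τ)) ^ 2 ≤
      2 / M * ((∑ z with F z = τ, boolSign (z j)) ^ 2 / #{z | F z = τ}) := by
    intro j τ
    have e : ∀ b, freq (fun z => F (update z j b)) τ = 2 * #{z | F z = τ ∧ z j = b} / M :=
      fun b => by
        unfold freq
        rw [hcard, card_filter_update]
        push_cast
        rfl
    rw [e, e]
    have hs : (#{z | F z = τ} : ℝ) = #{z | F z = τ ∧ z j = false} + #{z | F z = τ ∧ z j = true} := by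
      have h3 := Finset.card_filter_add_card_filter_not (s := ({z | F z = τ} :
        Finset (J → Bool))) (fun z => z j = false)
      rw [Finset.filter_filter, Finset.filter_filter] at h3
      simp only [Bool.not_eq_false] at h3
      exact_mod_cast h3.symm
    have hd : ∑ z with F z = τ, boolSign (z j) =
        (#{z | F z = τ ∧ z j = false} : ℝ) - #{z | F z = τ ∧ z j = true} := by
      unfold boolSign
      rw [Finset.sum_ite, Finset.filter_filter, Finset.filter_filter]
      simp
      ring
    rw [hs, hd]
    set u : ℝ := (#{z | F z = τ ∧ z j = false} : ℝ)
    set v : ℝ := (#{z | F z = τ ∧ z j = true} : ℝ)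
    have hu : 0 ≤ u := by positivity
    have hv : 0 ≤ v := by positivity
    have e1 : ∀ t : ℝ, √(2 * t / M) = √(2 / M) * √t := fun t => by
      rw [← Real.sqrt_mul (by positivity)]; ring_nf
    rw [e1, e1, ← mul_sub, mul_pow, Real.sq_sqrt (by positivity)]
    refine mul_le_mul_of_nonneg_left ?_ (by positivity)
    rcases (add_nonneg hu hv).eq_or_lt with h0 | h0
    · have hu0 : u = 0 := by linarith
      have hv0 : v = 0 := by linarith
      simp [hu0, hv0]
    · rw [le_div_iff₀ h0]
      have s1 := Real.sq_sqrt hu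
      have s2 := Real.sq_sqrt hv
      have p1 := Real.sqrt_nonneg u
      have p2 := Real.sqrt_nonneg v
      generalize √u = α at *
      generalize √v = β at *
      rw [← s1, ← s2]
      have : (α ^ 2 - β ^ 2) ^ 2 = (α - β) ^ 2 * (α + β) ^ 2 := by ring
      rw [this]
      refine mul_le_mul_of_nonneg_left ?_ (sq_nonneg _)
      nlinarith [mul_nonneg p1 p2]
  have hτ : ∀ τ, ∑ j, (∑ z with F z = τ, boolSign (z j)) ^ 2 / (#{z | F z = τ} : ℝ) ≤
      2 * (#{z | F z = τ} * Real.log (Fintype.card T) + M / Fintype.card T - #{z | F z = τ}) := by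
    intro τ
    rw [← Finset.sum_div]
    rcases ({z | F z = τ} : Finset (J → Bool)).eq_empty_or_nonempty with h0 | h0
    · simp [h0]
      positivity
    · have hs : (0 : ℝ) < #{z | F z = τ} := by exact_mod_cast h0.card_pos
      have h1 := level_one_inequality _ h0
      rw [div_le_iff₀ hs]
      refine h1.trans ?_
      rw [← hM]
      set s : ℝ := (#{z | F z = τ} : ℝ)
      -- Tangent line of `log`, i.e. comparison with equally large fibres: the corrections `M / |T|
      -- - s` cancel on summing over `τ`.
      have h2 : Real.log (M / s) ≤ Real.log (Fintype.card T) + M / (s * Fintype.card T) - 1 := by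
        have h3 := Real.log_le_sub_one_of_pos (x := M / (s * Fintype.card T)) (by positivity)
        rw [show M / (s * Fintype.card T) = M / s / Fintype.card T by field_simp,
          Real.log_div (by positivity) (by positivity)] at h3
        rw [show M / (s * Fintype.card T) = M / s / Fintype.card T by field_simp]
        linarith
      calc 2 * s ^ 2 * Real.log (M / s)
          ≤ 2 * s ^ 2 * (Real.log (Fintype.card T) + M / (s * Fintype.card T) - 1) :=
            mul_le_mul_of_nonneg_left h2 (by positivity)
        _ = _ := by field_simp
  have hsum : ∑ τ, (#{z | F z = τ} : ℝ) = M := by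
    rw [← hcard]
    norm_cast
    exact (Finset.card_eq_sum_card_fiberwise (f := F) (fun z _ => mem_coe.2 (mem_univ _))).symm
  calc ∑ j, hellingerSq (freq fun z => F (update z j false)) (freq fun z => F (update z j true))
      ≤ ∑ j, ∑ τ, 2 / M * ((∑ z with F z = τ, boolSign (z j)) ^ 2 / #{z | F z = τ}) :=
        Finset.sum_le_sum fun j _ => Finset.sum_le_sum fun τ _ => hstep j τ
    _ = 2 / M * ∑ τ, ∑ j, (∑ z with F z = τ, boolSign (z j)) ^ 2 / (#{z | F z = τ} : ℝ) := by
        rw [Finset.sum_comm, Finset.mul_sum]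
        simp_rw [Finset.mul_sum]
    _ ≤ 2 / M * ∑ τ, 2 * (#{z | F z = τ} * Real.log (Fintype.card T) + M / Fintype.card T -
          #{z | F z = τ}) :=
        mul_le_mul_of_nonneg_left (Finset.sum_le_sum fun τ _ => hτ τ) (by positivity)
    _ = 4 * Real.log (Fintype.card T) := by
        rw [← Finset.mul_sum, Finset.sum_sub_distrib, Finset.sum_add_distrib, ← Finset.sum_mul,
          hsum]
        simp only [sum_const, card_univ, nsmul_eq_mul]
        field_simp
        ring

end Cube

end SetDisjointness

namespace SetDisjointness

open Finset Function

/-! ### Set disjointness for maps with the rectangle property -/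

section Rectangle

variable {J : Type*}

/-- Alice's part of a random pair of disjoint sets: the elements of `z` assigned to Alice. -/
def aliceInput (D z : J → Bool) (j : J) : Bool := D j && z j

/-- Bob's part of a random pair of disjoint sets: the elements of `z` assigned to Bob. -/
def bobInput (D z : J → Bool) (j : J) : Bool := !D j && z j

variable [DecidableEq J] {T : Type*}

/-- The value of `Φ` on the pair of disjoint sets given by `D` and `z`, with the coordinate `j`
overwritten by `u` and `v`. -/
def planted (Φ : (J → Bool) → (J → Bool) → T) (D : J → Bool) (j : J) (u v : Bool)
    (z : J → Bool) : T :=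
  Φ (update (aliceInput D z) j u) (update (bobInput D z) j v)

theorem planted_update_left (Φ : (J → Bool) → (J → Bool) → T) (D : J → Bool) (j : J)
    (c u v : Bool) : planted Φ (update D j c) j u v = planted Φ D j u v := by
  funext z
  unfold planted
  congr 1 <;> funext i <;> by_cases h : i = j
  · subst h; simp
  · simp [h, aliceInput]
  · subst h; simp
  · simp [h, bobInput]

theorem planted_eq_update (Φ : (J → Bool) → (J → Bool) → T) (D : J → Bool) (j : J) (b : Bool)
    (z : J → Bool) :
    Φ (aliceInput D (update z j b)) (bobInput D (update z j b)) =
      planted Φ D j (D j && b) (!D j && b) z := by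
  unfold planted
  congr 1 <;> funext i <;> by_cases h : i = j
  · subst h; simp [aliceInput]
  · simp [h, aliceInput]
  · subst h; simp [bobInput]
  · simp [h, bobInput]

variable [Fintype J] [DecidableEq T]

/-- For fixed `D` Alice's and Bob's inputs depend on complementary coordinates of `z`, so exchanging
Bob's halves between two points is a bijection of pairs; the rectangle property keeps the value `τ`.
-/
theorem freq_planted_mul (Φ : (J → Bool) → (J → Bool) → T)
    (hΦ : ∀ x y x' y', Φ x y = Φ x' y' → Φ x y' = Φ x y) (D : J → Bool) (j : J) (τ : T) :
    freq (planted Φ D j false false) τ * freq (planted Φ D j true true) τ =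
      freq (planted Φ D j true false) τ * freq (planted Φ D j false true) τ := by
  have hΦ' : ∀ {x y x' y'}, Φ x y = τ → Φ x' y' = τ → Φ x y' = τ := fun h h' =>
    (hΦ _ _ _ _ (h.trans h'.symm)).trans h
  let mix : (J → Bool) → (J → Bool) → J → Bool := fun z z' i => if D i then z' i else z i
  have hA : ∀ z z', aliceInput D (mix z z') = aliceInput D z' := fun z z' => by
    funext i
    cases h : D i <;> simp [aliceInput, mix, h]
  have hB : ∀ z z', bobInput D (mix z z') = bobInput D z := fun z z' => by
    funext i
    cases h : D i <;> simp [bobInput, mix, h]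
  have hmix : ∀ z z', mix (mix z z') (mix z' z) = z := fun z z' => by
    funext i
    cases h : D i <;> simp [mix, h]
  have hcard : #{z | planted Φ D j false false z = τ} * #{z | planted Φ D j true true z = τ} =
      #{z | planted Φ D j true false z = τ} * #{z | planted Φ D j false true z = τ} := by
    rw [← Finset.card_product, ← Finset.card_product]
    refine Finset.card_nbij' (fun p => (mix p.1 p.2, mix p.2 p.1))
      (fun p => (mix p.1 p.2, mix p.2 p.1)) ?_ ?_ ?_ ?_
    · rintro ⟨z, z'⟩ h
      simp only [mem_coe, mem_product, mem_filter, mem_univ, true_and] at h ⊢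
      simp only [planted, hA, hB] at h ⊢
      exact ⟨hΦ' h.2 h.1, hΦ' h.1 h.2⟩
    · rintro ⟨z, z'⟩ h
      simp only [mem_coe, mem_product, mem_filter, mem_univ, true_and] at h ⊢
      simp only [planted, hA, hB] at h ⊢
      exact ⟨hΦ' h.2 h.1, hΦ' h.1 h.2⟩
    · rintro ⟨z, z'⟩ _
      simp [hmix]
    · rintro ⟨z, z'⟩ _
      simp [hmix]
  unfold freq
  rw [div_mul_div_comm, div_mul_div_comm]
  congr 1
  exact_mod_cast hcard

variable [Fintype T]

theorem sum_hellingerSq_planted_le (Φ : (J → Bool) → (J → Bool) → T) :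
    ∑ D : J → Bool, ∑ j,
      (hellingerSq (freq (planted Φ D j false false)) (freq (planted Φ D j true false)) +
        hellingerSq (freq (planted Φ D j false false)) (freq (planted Φ D j false true))) ≤
      2 * (2 ^ Fintype.card J * (4 * Real.log (Fintype.card T))) := by
  set H : (J → Bool) → J → ℝ := fun D j =>
    hellingerSq (freq (planted Φ D j false false)) (freq (planted Φ D j (D j) (!D j))) with hH
  have h1 : ∀ D, ∑ j, H D j ≤ 4 * Real.log (Fintype.card T) := fun D => by
    refine le_trans (le_of_eq ?_)
      (sum_hellingerSq_update_le fun z => Φ (aliceInput D z) (bobInput D z))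
    simp only [planted_eq_update, Bool.and_false, Bool.and_true]
    rfl
  have h2 : ∀ j, ∑ D, (hellingerSq (freq (planted Φ D j false false))
        (freq (planted Φ D j true false)) +
      hellingerSq (freq (planted Φ D j false false)) (freq (planted Φ D j false true))) =
      2 * ∑ D, H D j := fun j => by
    -- The planted map ignores `D j`, so flipping `D j` only exchanges which party receives the
    -- element `j`.
    have hinv : Involutive fun D : J → Bool => update D j (!D j) := fun D => by simp
    have h3 : ∑ D, H D j = ∑ D, H (update D j (!D j)) j :=
      (Equiv.sum_comp hinv.toPerm fun D => H D j).symm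
    rw [two_mul]
    nth_rw 2 [h3]
    rw [← Finset.sum_add_distrib]
    refine Finset.sum_congr rfl fun D _ => ?_
    simp only [hH, planted_update_left, update_self]
    cases D j
    · exact add_comm _ _
    · rfl
  rw [Finset.sum_comm]
  simp_rw [h2]
  rw [← Finset.mul_sum, Finset.sum_comm]
  refine mul_le_mul_of_nonneg_left ?_ (by norm_num)
  refine (Finset.sum_le_sum fun D _ => h1 D).trans (le_of_eq ?_)
  simp

/-- A linear lower bound for set disjointness: if `Φ` has the rectangle property of the transcripts
of a two-party protocol, and on average over the pairs of disjoint sets given by `D` and `z` and the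
planted coordinate `j` the answers read off from `Φ` are right with probability at least `2/3`, then
`Φ` has exponentially many values. -/
theorem card_le_log_card (Φ : (J → Bool) → (J → Bool) → T)
    (hΦ : ∀ x y x' y', Φ x y = Φ x' y' → Φ x y' = Φ x y) (acc : T → Prop) [DecidablePred acc]
    (herr : (∑ D : J → Bool, ∑ j, (#{z | acc (planted Φ D j false false z)} +
        #{z | ¬ acc (planted Φ D j true true z)}) : ℝ) ≤
      2 / 3 * Fintype.card J * 2 ^ Fintype.card J * 2 ^ Fintype.card J) :
    (Fintype.card J : ℝ) ≤ 576 * Real.log (Fintype.card T) := by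
  set M : ℝ := 2 ^ Fintype.card J with hM
  have hMpos : 0 < M := by positivity
  have hcard : ((Fintype.card (J → Bool) : ℕ) : ℝ) = M := by simp [hM]
  -- Here `5 / 6 = 1 - 1 / 6` and `12 = 6 * 2`, from the AM-GM bound and the triangle inequality.
  -- Cut-and-paste replaces the pair (0,0), (1,1) by (1,0), (0,1), both at bounded total distance
  -- from (0,0).
  have h1 : ∀ D j, 5 / 6 - ((#{z | acc (planted Φ D j false false z)} : ℝ) +
        #{z | ¬ acc (planted Φ D j true true z)}) / M ≤
      12 * (hellingerSq (freq (planted Φ D j false false)) (freq (planted Φ D j true false)) +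
        hellingerSq (freq (planted Φ D j false false)) (freq (planted Φ D j false true))) := by
    intro D j
    have e1 := sum_sub_le_hellingerSq (freq_nonneg (planted Φ D j false false))
      (freq_nonneg (planted Φ D j true true)) (sum_freq _) (sum_freq _) {τ | acc τ}
    rw [hellingerSq_eq_of_mul_eq (freq_nonneg _) (freq_nonneg _) (freq_nonneg _) (freq_nonneg _)
      (sum_freq _) (sum_freq _) (sum_freq _) (sum_freq _) (freq_planted_mul Φ hΦ D j),
      Finset.sum_sub_distrib, sum_freq_filter, sum_freq_filter, hcard] at e1
    have e2 := hellingerSq_le_two_mul_add (freq (planted Φ D j false false))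
      (freq (planted Φ D j true false)) (freq (planted Φ D j false true))
    have e3 : (#{z | acc (planted Φ D j true true z)} : ℝ) / M =
        1 - #{z | ¬ acc (planted Φ D j true true z)} / M := by
      rw [eq_sub_iff_add_eq, ← add_div, div_eq_one_iff_eq hMpos.ne', ← hcard]
      have := Finset.card_filter_add_card_filter_not (s := (univ : Finset (J → Bool)))
        (fun z => acc (planted Φ D j true true z))
      rw [Finset.card_univ] at this
      exact_mod_cast this
    rw [e3] at e1
    rw [add_div]
    linarith
  have h2 := Finset.sum_le_sum fun D (_ : D ∈ (univ : Finset (J → Bool))) =>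
    Finset.sum_le_sum fun j (_ : j ∈ (univ : Finset J)) => h1 D j
  simp_rw [← Finset.mul_sum, Finset.sum_sub_distrib, ← Finset.sum_div] at h2
  simp only [sum_const, card_univ, nsmul_eq_mul, hcard] at h2
  have h3 := sum_hellingerSq_planted_le Φ
  rw [← hM] at h3
  have h4 := (div_le_div_iff_of_pos_right hMpos).2 herr
  have h5 : 2 / 3 * (Fintype.card J : ℝ) * M * M / M = 2 / 3 * (Fintype.card J : ℝ) * M := by
    field_simp
  rw [h5] at h4
  have h6 : M * ((Fintype.card J : ℝ) * (1 / 6)) ≤ M * (96 * Real.log (Fintype.card T)) := by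
    linarith
  have h7 := le_of_mul_le_mul_left h6 hMpos
  linarith

end Rectangle

end SetDisjointness

/-! ### Transcripts across a cut, and fixing the randomness -/

namespace Congest

open Finset

noncomputable instance (w : ℕ) : Fintype (Message w) :=
  Fintype.ofInjective (β := Fin w → Option Bool) (fun l i => l.1[i.1]?) fun l l' h => by
    refine Subtype.ext (List.ext_getElem? fun i => ?_)
    by_cases hi : i < w
    · exact congrFun h ⟨i, hi⟩
    · rw [List.getElem?_eq_none (l.2.trans (not_lt.1 hi)),
        List.getElem?_eq_none (l'.2.trans (not_lt.1 hi))]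

theorem card_message_le (w : ℕ) : Fintype.card (Message w) ≤ 3 ^ w := by
  have h := Fintype.card_le_of_injective (β := Fin w → Option Bool)
    (fun (l : Message w) i => l.1[i.1]?) fun l l' h => by
      refine Subtype.ext (List.ext_getElem? fun i => ?_)
      by_cases hi : i < w
      · exact congrFun h ⟨i, hi⟩
      · rw [List.getElem?_eq_none (l.2.trans (not_lt.1 hi)),
          List.getElem?_eq_none (l'.2.trans (not_lt.1 hi))]
  simpa using h

namespace Algorithm

variable {b w : ℕ} {V X Y : Type} (A : Algorithm b w) (ident : V ↪ Ident b) (s : A.Shared)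
  (p : V → A.Private)

theorem stateAt_succ_congr {G G' : SimpleGraph V} {t : ℕ} {v : V}
    (hG : ∀ u, G.Adj v u ↔ G'.Adj v u)
    (hv : A.stateAt G ident s p t v = A.stateAt G' ident s p t v)
    (hu : ∀ u, G.Adj v u → A.send (A.stateAt G ident s p t u) (ident v) =
      A.send (A.stateAt G' ident s p t u) (ident v)) :
    A.stateAt G ident s p (t + 1) v = A.stateAt G' ident s p (t + 1) v := by
  simp only [stateAt]
  rw [hv]
  congr 1
  ext m
  simp only [Set.mem_ofPred_eq]
  refine exists_congr fun u => ?_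
  rw [← hG]
  refine and_congr_right fun h => ?_
  rw [hu u h]

theorem stateAt_zero_congr {G G' : SimpleGraph V} {v : V} (hG : ∀ u, G.Adj v u ↔ G'.Adj v u) :
    A.stateAt G ident s p 0 v = A.stateAt G' ident s p 0 v := by
  simp only [stateAt]
  congr 2
  ext u
  exact hG u

/-- What crosses the cut between the vertex set `S` and its complement in the first `r` rounds,
together with the answers of the two sides. -/
noncomputable def transcript (r : ℕ) (S : Set V) (E : Finset (V × V)) (G : SimpleGraph V) :
    (Fin r → E → Message w) × Bool × Bool :=
  open Classical in
  (fun t e => A.send (A.stateAt G ident s p t e.1.1) (ident e.1.2),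
    decide (∃ v ∈ S, A.output (A.stateAt G ident s p r v) = true),
    decide (∃ v ∉ S, A.output (A.stateAt G ident s p r v) = true))

theorem accepts_iff_transcript (r : ℕ) (S : Set V) (E : Finset (V × V)) (G : SimpleGraph V) :
    A.Accepts r G ident s p ↔ ((A.transcript ident s p r S E G).2.1 = true ∨
      (A.transcript ident s p r S E G).2.2 = true) := by
  simp only [Accepts, transcript, decide_eq_true_eq]
  constructor
  · rintro ⟨v, hv⟩
    by_cases h : v ∈ S
    · exact Or.inl ⟨v, h, hv⟩
    · exact Or.inr ⟨v, h, hv⟩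
  · rintro (⟨v, -, hv⟩ | ⟨v, -, hv⟩) <;> exact ⟨v, hv⟩

section Cut

variable {ident s p} {S : Set V} {E : Finset (V × V)} {G : X → Y → SimpleGraph V}

/-- On the mixed input each side cannot tell that the other side's input was exchanged: its own
edges are unchanged, and all incoming cut messages agree by equality of the transcripts. Induction
on the round. -/
theorem stateAt_eq_of_transcript_eq
    (hS : ∀ v ∈ S, ∀ u x y y', (G x y).Adj v u ↔ (G x y').Adj v u)
    (hS' : ∀ v ∉ S, ∀ u x x' y, (G x y).Adj v u ↔ (G x' y).Adj v u)
    (hE : ∀ v u x y, (G x y).Adj v u → (v ∈ S ↔ u ∉ S) → (v, u) ∈ E)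
    {r : ℕ} {x x' : X} {y y' : Y}
    (h : A.transcript ident s p r S E (G x y) = A.transcript ident s p r S E (G x' y')) :
    ∀ t ≤ r, (∀ v ∈ S, A.stateAt (G x y') ident s p t v = A.stateAt (G x y) ident s p t v) ∧
      ∀ v ∉ S, A.stateAt (G x y') ident s p t v = A.stateAt (G x' y') ident s p t v := by
  intro t
  induction t with
  | zero =>
    intro _
    exact ⟨fun v hv => A.stateAt_zero_congr ident s p fun u => hS v hv u _ _ _,
      fun v hv => A.stateAt_zero_congr ident s p fun u => hS' v hv u _ _ _⟩
  | succ t ih =>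
    intro ht
    obtain ⟨ih1, ih2⟩ := ih (by omega)
    have hmsg : ∀ v u, (v, u) ∈ E → A.send (A.stateAt (G x y) ident s p t v) (ident u) =
        A.send (A.stateAt (G x' y') ident s p t v) (ident u) := fun v u he =>
      congrFun (congrFun (congrArg Prod.fst h) ⟨t, ht⟩) ⟨(v, u), he⟩
    refine ⟨fun v hv => A.stateAt_succ_congr ident s p (fun u => hS v hv u _ _ _) (ih1 v hv)
      fun u huv => ?_, fun v hv => A.stateAt_succ_congr ident s p (fun u => hS' v hv u _ _ _)
      (ih2 v hv) fun u huv => ?_⟩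
    · by_cases hu : u ∈ S
      · rw [ih1 u hu]
      · rw [ih2 u hu, hmsg u v (hE u v x y' huv.symm (by tauto))]
    · by_cases hu : u ∈ S
      · rw [ih1 u hu, hmsg u v (hE u v x y' huv.symm (by tauto))]
      · rw [ih2 u hu]

theorem transcript_rectangle
    (hS : ∀ v ∈ S, ∀ u x y y', (G x y).Adj v u ↔ (G x y').Adj v u)
    (hS' : ∀ v ∉ S, ∀ u x x' y, (G x y).Adj v u ↔ (G x' y).Adj v u)
    (hE : ∀ v u x y, (G x y).Adj v u → (v ∈ S ↔ u ∉ S) → (v, u) ∈ E)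
    {r : ℕ} (x : X) (y : Y) (x' : X) (y' : Y)
    (h : A.transcript ident s p r S E (G x y) = A.transcript ident s p r S E (G x' y')) :
    A.transcript ident s p r S E (G x y') = A.transcript ident s p r S E (G x y) := by
  have hst := A.stateAt_eq_of_transcript_eq hS hS' hE h
  refine Prod.ext ?_ (Prod.ext ?_ ?_)
  · funext t e
    by_cases he : e.1.1 ∈ S
    · simp only [transcript]
      rw [(hst t t.2.le).1 _ he]
    · rw [h]
      simp only [transcript]
      rw [(hst t t.2.le).2 _ he]
  · simp only [transcript, decide_eq_decide]
    refine exists_congr fun v => and_congr_right fun hv => ?_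
    rw [(hst r le_rfl).1 v hv]
  · rw [h]
    simp only [transcript, decide_eq_decide]
    refine exists_congr fun v => and_congr_right fun hv => ?_
    rw [(hst r le_rfl).2 v hv]

end Cut

end Algorithm

/-- The averaging step of Yao's principle: some fixed seed errs on at most a third of the instances.
-/
theorem exists_card_mul_le {Ω ι : Type*} [MeasurableSpace Ω] (μ : Measure Ω)
    [IsProbabilityMeasure μ] [Fintype ι] (bad : ι → Set Ω) (hbad : ∀ i, μ (bad i) ≤ 1 / 3) :
    ∃ ω, (Nat.card {i // ω ∈ bad i} : ℝ) ≤ Fintype.card ι / 3 := by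
  classical
  -- The maps of an algorithm need not be measurable, so the bad sets are replaced by measurable
  -- hulls of the same measure.
  obtain ⟨ω, hω⟩ := exists_le_lintegral (μ := μ)
    (f := fun ω => ∑ i, (toMeasurable μ (bad i)).indicator 1 ω)
    (Finset.measurable_sum _ fun i _ =>
      measurable_one.indicator (measurableSet_toMeasurable _ _)).aemeasurable
  refine ⟨ω, ?_⟩
  rw [lintegral_finsetSum _ fun i _ =>
    measurable_one.indicator (measurableSet_toMeasurable _ _)] at hω
  simp_rw [lintegral_indicator_one (measurableSet_toMeasurable _ _), measure_toMeasurable] at hω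
  have h1 : ∑ i, μ (bad i) ≤ ((Fintype.card ι / 3 : NNReal) : ENNReal) := by
    refine (Finset.sum_le_sum fun i _ => hbad i).trans (le_of_eq ?_)
    rw [Finset.sum_const, Finset.card_univ, nsmul_eq_mul, ENNReal.coe_div (by norm_num)]
    rw [mul_one_div]
    simp
  have h2 : ((Nat.card {i // ω ∈ bad i} : NNReal) : ENNReal) ≤
      ∑ i, (toMeasurable μ (bad i)).indicator (1 : Ω → ENNReal) ω := by
    calc ((Nat.card {i // ω ∈ bad i} : NNReal) : ENNReal)
        = ∑ i, (bad i).indicator (1 : Ω → ENNReal) ω := by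
          simp only [Set.indicator_apply, Pi.one_apply, Finset.sum_boole]
          rw [Nat.card_eq_fintype_card, Fintype.card_subtype]
          simp
      _ ≤ _ := Finset.sum_le_sum fun i _ =>
          Set.indicator_le_indicator_of_subset (subset_toMeasurable _ _) (fun _ => zero_le) _
  have h3 := ENNReal.coe_le_coe.1 (h2.trans (hω.trans h1))
  exact_mod_cast h3

end Congest

/-! ### Induced cycles in the gadget -/

namespace InducedCycle

section Cyclic

variable {k : ℕ}

theorem natCast_zmod_ne_zero {n : ℕ} (h0 : 0 < n) (hn : n < k) : (n : ZMod k) ≠ 0 := by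
  rw [Ne, ZMod.natCast_eq_zero_iff]
  exact fun h => absurd (Nat.le_of_dvd h0 h) (by omega)

/-- The steps around the cycle sum to zero, that is `k * β + |P| * (α - β) = 0` in `ZMod k`; hence
`k` divides `|P| ≤ k`, and `P` is empty or everything. -/
theorem forall_step_eq_of_isUnit_sub [NeZero k] {c : ZMod k → ZMod k} {α β : ZMod k}
    (hu : IsUnit (α - β)) (h : ∀ a, c (a + 1) = c a + α ∨ c (a + 1) = c a + β) :
    (∀ a, c (a + 1) = c a + α) ∨ ∀ a, c (a + 1) = c a + β := by
  classical
  set P : Finset (ZMod k) := {a | c (a + 1) = c a + α} with hP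
  have hsum : ∑ a, (c (a + 1) - c a) = 0 := by
    rw [Finset.sum_sub_distrib, sub_eq_zero]
    exact Equiv.sum_comp (Equiv.addRight (1 : ZMod k)) c
  have hstep : ∀ a, c (a + 1) - c a = β + if a ∈ P then α - β else 0 := by
    intro a
    by_cases ha : a ∈ P
    · rw [if_pos ha, (Finset.mem_filter.1 ha).2]; ring
    · have h1 : c (a + 1) = c a + β := (h a).resolve_left fun h2 => ha (by simp [hP, h2])
      rw [if_neg ha, h1]; ring
  simp_rw [hstep] at hsum
  rw [Finset.sum_add_distrib, Finset.sum_const, Finset.card_univ, ZMod.card, nsmul_eq_mul,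
    ZMod.natCast_self, zero_mul, zero_add, Finset.sum_ite_mem, Finset.univ_inter,
    Finset.sum_const, nsmul_eq_mul, hu.mul_left_eq_zero, ZMod.natCast_eq_zero_iff] at hsum
  have hle : P.card ≤ k := by simpa using Finset.card_le_univ P
  rcases Nat.eq_zero_or_pos P.card with h0 | h0
  · right
    intro a
    rw [Finset.card_eq_zero] at h0
    exact (h a).resolve_left fun h2 => by
      have : a ∈ P := by simp [hP, h2]
      simp [h0] at this
  · left
    intro a
    have h1 : P.card = Fintype.card (ZMod k) := by
      rw [ZMod.card]; exact le_antisymm hle (Nat.le_of_dvd h0 hsum)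
    rw [Finset.card_eq_iff_eq_univ] at h1
    have : a ∈ P := by rw [h1]; exact Finset.mem_univ a
    exact (Finset.mem_filter.1 this).2

end Cyclic

variable {V : Type} {k : ℕ}

/-- The two levels of `ZMod k` below which the input edges lie. -/
def IsHub (ℓ : ZMod k) : Prop := ℓ = 0 ∨ ℓ = (k / 2 : ℕ)

theorem not_isHub_add (hev : Even k) {ℓ : ZMod k} (hℓ : IsHub ℓ) {t : ℕ} (h0 : 0 < t)
    (ht : t < k / 2) : ¬ IsHub (ℓ + (t : ZMod k)) := by
  obtain ⟨h, rfl⟩ := hev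
  have hh : (h + h) / 2 = h := by omega
  have hz : (h : ZMod (h + h)) + h = 0 := by rw [← Nat.cast_add, ZMod.natCast_self]
  unfold IsHub at *
  rw [hh] at hℓ ht ⊢
  have n1 : (t : ZMod (h + h)) ≠ 0 := natCast_zmod_ne_zero h0 (by omega)
  have n2 : (t : ZMod (h + h)) ≠ h := fun h' => by
    have : ((h + t : ℕ) : ZMod (h + h)) ≠ 0 := natCast_zmod_ne_zero (by omega) (by omega)
    push_cast at this
    exact this (by rw [h', hz])
  rcases hℓ with rfl | rfl
  · rw [zero_add]; tauto
  · rintro (h' | h')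
    · exact n2 (by linear_combination h' - hz)
    · exact n1 (by linear_combination h')

/-- The edges from one level to the next one. Between most levels they form a matching; below the
two hubs they are given by the two inputs `x` and `y`. -/
def Up (level : V → ZMod k) (idx : V → ℕ) (x y : ℕ → ℕ → Prop) (u v : V) : Prop :=
  level v = level u + 1 ∧ (level v = 0 → x (idx v) (idx u)) ∧
    (level v = (k / 2 : ℕ) → y (idx u) (idx v)) ∧ (¬ IsHub (level v) → idx u = idx v)

/-- The network encoding the instance `x`, `y` of set disjointness. The levels are arranged
cyclically; if `k` is even, the two hubs are moreover cliques. -/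
def gadget (hk : 4 ≤ k) (level : V → ZMod k) (idx : V → ℕ) (x y : ℕ → ℕ → Prop) :
    SimpleGraph V where
  Adj u v := Up level idx x y u v ∨ Up level idx x y v u ∨
    Even k ∧ u ≠ v ∧ level u = level v ∧ IsHub (level u)
  symm := ⟨fun u v h => by
    rcases h with h | h | ⟨h1, h2, h3, h4⟩
    · exact Or.inr (Or.inl h)
    · exact Or.inl h
    · exact Or.inr (Or.inr ⟨h1, h2.symm, h3.symm, h3 ▸ h4⟩)⟩
  loopless := ⟨fun u h => by
    have h1 : ((1 : ℕ) : ZMod k) ≠ 0 := natCast_zmod_ne_zero one_pos (by omega)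
    rw [Nat.cast_one] at h1
    rcases h with h | h | h
    · exact h1 (left_eq_add.1 h.1)
    · exact h1 (left_eq_add.1 h.1)
    · exact h.2.1 rfl⟩

/-- `f` runs around an induced cycle of `G`. -/
structure IsInducedCycle (G : SimpleGraph V) (f : ZMod k → V) : Prop where
  injective : Function.Injective f
  adj_iff : ∀ a b, G.Adj (f a) (f b) ↔ b = a + 1 ∨ a = b + 1

theorem IsInducedCycle.neg {G : SimpleGraph V} {f : ZMod k → V} (h : IsInducedCycle G f) :
    IsInducedCycle G fun a => f (-a) where
  injective a b hab := neg_injective (h.injective hab)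
  adj_iff a b := by
    rw [h.adj_iff]
    constructor <;> rintro (h | h)
    · right; linear_combination h
    · left; linear_combination h
    · right; linear_combination h
    · left; linear_combination h

theorem isIndContained_cycleGraph_iff (hk : 4 ≤ k) (G : SimpleGraph V) :
    (SimpleGraph.cycleGraph k).IsIndContained G ↔ ∃ f : ZMod k → V, IsInducedCycle G f := by
  obtain ⟨k, rfl⟩ : ∃ j, k = j + 2 := ⟨k - 2, by omega⟩
  have key : ∀ a b : ZMod (k + 2), (SimpleGraph.cycleGraph (k + 2)).Adj a b ↔
      b = a + 1 ∨ a = b + 1 := fun a b => by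
    have h : (SimpleGraph.cycleGraph (k + 2)).Adj a b ↔ a - b = (1 : ZMod (k + 2)) ∨
      b - a = (1 : ZMod (k + 2)) := SimpleGraph.cycleGraph_adj
    rw [h, sub_eq_iff_eq_add', sub_eq_iff_eq_add', or_comm]
  constructor
  · rintro ⟨f⟩
    exact ⟨f, f.injective, fun a b => (f.map_rel_iff).trans (key a b)⟩
  · rintro ⟨f, h⟩
    exact ⟨⟨⟨f, h.injective⟩, fun {a b} => (h.adj_iff a b).trans (key a b).symm⟩⟩

section

variable {hk : 4 ≤ k} {level : V → ZMod k} {idx : V → ℕ} {x y : ℕ → ℕ → Prop}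

/-- One vertex per level: index `i` below level `k / 2`, `j` from there on. Clique edges cannot be
chords, since they join vertices of one level. -/
theorem exists_induced_cycle (i j : ℕ)
    (hi : ∀ ℓ, ∃ v, level v = ℓ ∧ idx v = i) (hj : ∀ ℓ, ∃ v, level v = ℓ ∧ idx v = j)
    (hx : x i j) (hy : y i j) : ∃ f : ZMod k → V, IsInducedCycle (gadget hk level idx x y) f := by
  have : NeZero k := ⟨by omega⟩
  have : ∀ ℓ : ZMod k, ∃ v, level v = ℓ ∧ idx v = if ℓ.val < k / 2 then i else j := fun ℓ => by
    split_ifs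
    exacts [hi ℓ, hj ℓ]
  choose f hl hf using this
  have hup : ∀ a, Up level idx x y (f a) (f (a + 1)) := by
    intro a
    have hval : a + 1 ≠ 0 → (a + 1).val = a.val + 1 := fun h => by
      have hlt : a.val + 1 < k := by
        refine lt_of_le_of_ne a.val_lt fun h' => h ?_
        have h2 : ((a.val + 1 : ℕ) : ZMod k) = a + 1 := by simp
        rw [← h2, h', ZMod.natCast_self]
      have : Fact (1 < k) := ⟨by omega⟩
      rw [ZMod.val_add_of_lt] <;> rw [ZMod.val_one]
      exact hlt
    refine ⟨by rw [hl, hl], fun h => ?_, fun h => ?_, fun h => ?_⟩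
    · rw [hl] at h
      have ha : a.val = k - 1 := by
        have : a = ((k - 1 : ℕ) : ZMod k) := by
          rw [Nat.cast_sub (by omega), ZMod.natCast_self]
          linear_combination h
        rw [this, ZMod.val_natCast_of_lt (by omega)]
      rw [hf, hf, h, ha, if_pos (by rw [ZMod.val_zero]; omega), if_neg (by omega)]
      exact hx
    · rw [hl] at h
      have h0 : a + 1 ≠ 0 := by
        rw [h]; exact natCast_zmod_ne_zero (by omega) (by omega)
      have h1 : (a + 1).val = k / 2 := by rw [h, ZMod.val_natCast_of_lt (by omega)]
      have h2 := hval h0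
      rw [hf, hf, if_pos (by omega), if_neg (by omega)]
      exact hy
    · rw [hl] at h
      have h2 := hval fun h0 => h (Or.inl h0)
      have h3 : (a + 1).val ≠ k / 2 := fun h3 => h (Or.inr (by rw [← h3]; simp))
      rw [hf, hf]
      congr 1
      rw [eq_iff_iff]
      omega
  refine ⟨f, fun a b hab => by rw [← hl a, hab, hl], fun a b => ⟨?_, ?_⟩⟩
  · rintro (h | h | h)
    · left; simpa only [hl] using h.1
    · right; simpa only [hl] using h.1
    · exact absurd (congrArg f (by simpa only [hl] using h.2.2.1)) h.2.1
  · rintro (rfl | rfl)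
    · exact Or.inl (hup a)
    · exact Or.inr (Or.inl (hup b))

/-- After rotation the cycle meets every level at the position of that level. The index changes only
on entering a hub, so it is constant on each half, and the two edges entering the hubs witness `x`
and `y` for the same pair. -/
theorem exists_inputs_of_winding (hk : 4 ≤ k) {f : ZMod k → V}
    (hup : ∀ a, Up level idx x y (f a) (f (a + 1))) : ∃ i j, x i j ∧ y i j := by
  have : NeZero k := ⟨by omega⟩
  have hc : ∀ n : ℕ, level (f n) = level (f 0) + n := by
    intro n
    induction n with
    | zero => simp
    | succ n ih => rw [Nat.cast_succ, (hup n).1, ih]; ring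
  set g : ZMod k → V := fun a => f (a - level (f 0)) with hg
  have hgl : ∀ a, level (g a) = a := fun a => by
    have := hc (a - level (f 0)).val
    rw [ZMod.natCast_zmod_val] at this
    rw [hg, this]; ring
  have hgup : ∀ a, Up level idx x y (g a) (g (a + 1)) := fun a => by
    have := hup (a - level (f 0))
    rwa [show a - level (f 0) + 1 = a + 1 - level (f 0) by ring] at this
  have hconst : ∀ n₀ n : ℕ, (∀ t, n₀ < t → t ≤ n₀ + n → ¬ IsHub ((t : ℕ) : ZMod k)) →
      idx (g ((n₀ + n : ℕ) : ZMod k)) = idx (g n₀) := by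
    intro n₀ n
    induction n with
    | zero => intro _; rfl
    | succ n ih =>
      intro h
      rw [← ih fun t h1 h2 => h t h1 (by omega)]
      have h1 := (hgup ((n₀ + n : ℕ) : ZMod k)).2.2.2
      rw [hgl] at h1
      have h2 := h (n₀ + n + 1) (by omega) (by omega)
      rw [Nat.cast_succ] at h2
      rw [← add_assoc, Nat.cast_succ]
      exact (h1 h2).symm
  have hhub : ∀ t : ℕ, 0 < t → t < k → t ≠ k / 2 → ¬ IsHub (t : ZMod k) := by
    rintro t h0 h1 h2 (h | h)
    · exact natCast_zmod_ne_zero h0 h1 h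
    · apply h2
      have := congrArg ZMod.val h
      rwa [ZMod.val_natCast_of_lt h1, ZMod.val_natCast_of_lt (by omega)] at this
  have h1 := hconst 0 (k / 2 - 1) fun t ht ht' => hhub t ht (by omega) (by omega)
  have h2 := hconst (k / 2) (k - 1 - k / 2) fun t ht ht' => hhub t (by omega) (by omega) (by omega)
  rw [zero_add] at h1
  rw [show k / 2 + (k - 1 - k / 2) = k - 1 by omega] at h2
  have e1 : ((k - 1 : ℕ) : ZMod k) + 1 = 0 := by
    rw [Nat.cast_sub (by omega), ZMod.natCast_self]; simp
  have e2 : ((k / 2 - 1 : ℕ) : ZMod k) + 1 = (k / 2 : ℕ) := by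
    rw [Nat.cast_sub (by omega)]; simp
  have h3 := (hgup ((k - 1 : ℕ) : ZMod k)).2.1
  have h4 := (hgup ((k / 2 - 1 : ℕ) : ZMod k)).2.2.1
  rw [e1] at h3
  rw [e2] at h4
  rw [h1] at h4
  rw [h2] at h3
  rw [Nat.cast_zero] at h4
  exact ⟨_, _, h3 (hgl _), h4 (hgl _)⟩

variable {f : ZMod k → V}

theorem one_two_three_ne_zero (hk : 4 ≤ k) :
    (1 : ZMod k) ≠ 0 ∧ (2 : ZMod k) ≠ 0 ∧ (3 : ZMod k) ≠ 0 := by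
  refine ⟨?_, ?_, ?_⟩
  · simpa using natCast_zmod_ne_zero (k := k) (n := 1) (by omega) (by omega)
  · simpa using natCast_zmod_ne_zero (k := k) (n := 2) (by omega) (by omega)
  · simpa using natCast_zmod_ne_zero (k := k) (n := 3) (by omega) (by omega)

theorem up_of_level (hf : IsInducedCycle (gadget hk level idx x y) f) {a b : ZMod k}
    (hab : b = a + 1 ∨ a = b + 1) (h : level (f b) = level (f a) + 1) :
    Up level idx x y (f a) (f b) := by
  obtain ⟨h1, h2, -⟩ := one_two_three_ne_zero hk
  rcases (hf.adj_iff a b).2 hab with h' | h' | h'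
  · exact h'
  · exact absurd (by linear_combination -h - h'.1) h2
  · exact absurd (by linear_combination -h - h'.2.2.1) h1

theorem exists_inputs_of_forall_up (hf : IsInducedCycle (gadget hk level idx x y) f)
    (h : ∀ a, level (f (a + 1)) = level (f a) + 1) : ∃ i j, x i j ∧ y i j :=
  exists_inputs_of_winding hk (f := f) fun a => up_of_level hf (Or.inl rfl) (h a)

theorem exists_inputs_of_forall_down (hf : IsInducedCycle (gadget hk level idx x y) f)
    (h : ∀ a, level (f (a + 1)) = level (f a) + -1) : ∃ i j, x i j ∧ y i j := by
  refine exists_inputs_of_forall_up hf.neg fun a => ?_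
  have := h (-(a + 1))
  rw [show -(a + 1) + 1 = -a by ring] at this
  rw [this]; ring

theorem level_step (hf : IsInducedCycle (gadget hk level idx x y) f) (a : ZMod k) :
    level (f (a + 1)) = level (f a) + 1 ∨ level (f (a + 1)) = level (f a) + -1 ∨
      (Even k ∧ level (f (a + 1)) = level (f a) ∧ IsHub (level (f a))) := by
  rcases (hf.adj_iff a (a + 1)).2 (Or.inl rfl) with h | h | h
  · exact Or.inl h.1
  · right; left; rw [h.1]; ring
  · exact Or.inr (Or.inr ⟨h.1, h.2.2.1.symm, h.2.2.2⟩)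

/-- All steps are `1` or `-1`, whose difference `2` is a unit for odd `k`. -/
theorem exists_inputs_of_odd (hodd : ¬ Even k) (hf : IsInducedCycle (gadget hk level idx x y) f) :
    ∃ i j, x i j ∧ y i j := by
  have : NeZero k := ⟨by omega⟩
  have hu : IsUnit ((1 : ZMod k) - -1) := by
    have h2 : IsUnit ((2 : ℕ) : ZMod k) := by
      rw [ZMod.isUnit_iff_coprime, Nat.coprime_two_left]
      exact Nat.not_even_iff_odd.1 hodd
    convert h2 using 1
    push_cast
    ring
  rcases forall_step_eq_of_isUnit_sub (c := fun a => level (f a)) hu fun a => by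
    rcases level_step hf a with h | h | h
    · exact Or.inl h
    · exact Or.inr h
    · exact absurd h.1 hodd with h | h
  · exact exists_inputs_of_forall_up hf h
  · exact exists_inputs_of_forall_down hf h


/-! ### Even `k`: excluding cycles that turn back -/

section Even

/-- If the level above is a hub, its clique joins the two neighbours by a chord; otherwise the
matching identifies them. -/
theorem not_valley (hev : Even k) (hinj : Function.Injective fun v => (level v, idx v))
    (hf : IsInducedCycle (gadget hk level idx x y) f) (a : ZMod k)
    (h1 : level (f (a - 1)) = level (f a) + 1) (h2 : level (f (a + 1)) = level (f a) + 1) :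
    False := by
  obtain ⟨t1, t2, t3⟩ := one_two_three_ne_zero hk
  have hne : f (a - 1) ≠ f (a + 1) := fun h => t2 (by linear_combination -hf.injective h)
  by_cases hhub : IsHub (level (f a) + 1)
  · have hadj : (gadget hk level idx x y).Adj (f (a - 1)) (f (a + 1)) :=
      Or.inr (Or.inr ⟨hev, hne, h1.trans h2.symm, h1 ▸ hhub⟩)
    rcases (hf.adj_iff _ _).1 hadj with h | h
    · exact t1 (by linear_combination h)
    · exact t3 (by linear_combination -h)
  · have u1 := (up_of_level hf (Or.inr (by ring)) h1).2.2.2 (h1 ▸ hhub)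
    have u2 := (up_of_level hf (Or.inl (by ring)) h2).2.2.2 (h2 ▸ hhub)
    exact hne (hinj (Prod.ext (h1.trans h2.symm) (u1.symm.trans u2)))

theorem not_peak (hinj : Function.Injective fun v => (level v, idx v))
    (hf : IsInducedCycle (gadget hk level idx x y) f) (a : ZMod k)
    (hhub : ¬ IsHub (level (f a))) (h1 : level (f a) = level (f (a - 1)) + 1)
    (h2 : level (f a) = level (f (a + 1)) + 1) : False := by
  obtain ⟨-, t2, -⟩ := one_two_three_ne_zero hk
  have u1 := (up_of_level hf (Or.inl (by ring)) h1).2.2.2 hhub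
  have u2 := (up_of_level hf (Or.inr (by ring)) h2).2.2.2 hhub
  have h : f (a - 1) = f (a + 1) :=
    hinj (Prod.ext (add_right_cancel (h1.symm.trans h2)) (u1.trans u2.symm))
  exact t2 (by linear_combination -hf.injective h)

theorem not_plateau (hf : IsInducedCycle (gadget hk level idx x y) f) (a : ZMod k)
    (h1 : level (f a) = level (f (a - 1))) (h2 : level (f (a + 1)) = level (f a)) : False := by
  obtain ⟨t1, t2, t3⟩ := one_two_three_ne_zero hk
  have hflat : Even k ∧ IsHub (level (f a)) := by
    rcases level_step hf a with h | h | h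
    · exact absurd (by linear_combination h2 - h) t1
    · exact absurd (by linear_combination h - h2) t1
    · exact ⟨h.1, h.2.2⟩
  have hne : f (a - 1) ≠ f (a + 1) := fun h => t2 (by linear_combination -hf.injective h)
  have hadj : (gadget hk level idx x y).Adj (f (a - 1)) (f (a + 1)) :=
    Or.inr (Or.inr ⟨hflat.1, hne, h1.symm.trans h2.symm, h1 ▸ hflat.2⟩)
  rcases (hf.adj_iff _ _).1 hadj with h | h
  · exact t1 (by linear_combination h)
  · exact t3 (by linear_combination -h)

/-- Between hubs there are no flat edges and no peaks, so a path that starts to rise from a hub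
keeps rising until the next one. -/
theorem level_climb (hev : Even k) (hinj : Function.Injective fun v => (level v, idx v))
    (hf : IsInducedCycle (gadget hk level idx x y) f) (a : ZMod k) (ha : IsHub (level (f a)))
    (h1 : level (f (a + 1)) = level (f a) + 1) (t : ℕ) (ht : t + 1 < k / 2) :
    level (f (a + t)) = level (f a) + t ∧ level (f (a + t + 1)) = level (f a) + t + 1 := by
  induction t with
  | zero => simpa using h1
  | succ t ih =>
    obtain ⟨ih1, ih2⟩ := ih (by omega)
    have hnh := not_isHub_add hev ha (t := t + 1) (by omega) (by omega)
    push_cast at hnh ⊢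
    rw [← add_assoc] at hnh ⊢
    rw [← add_assoc]
    refine ⟨ih2, ?_⟩
    rw [← ih2] at hnh ⊢
    rcases level_step hf (a + t + 1) with h | h | h
    · exact h
    · refine (not_peak hinj hf _ hnh ?_ ?_).elim
      · rw [add_sub_cancel_right, ih1, ih2]
      · rw [h]; ring
    · exact absurd h.2.2 hnh

/-- Both ends of the flat edge climb `k / 2 - 1` levels. Together with that edge this uses `k - 1`
edges, so the closing edge would join two vertices of the same non-hub level. -/
theorem not_trough (hev : Even k) (hinj : Function.Injective fun v => (level v, idx v))
    (hf : IsInducedCycle (gadget hk level idx x y) f) (a : ZMod k)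
    (h0 : level (f (a + 1)) = level (f a)) (h1 : level (f (a - 1)) = level (f a) + 1)
    (h2 : level (f (a + 1 + 1)) = level (f (a + 1)) + 1) : False := by
  obtain ⟨t1, -, -⟩ := one_two_three_ne_zero hk
  have hhub : IsHub (level (f a)) := by
    rcases level_step hf a with h | h | h
    · exact absurd (by linear_combination h0 - h) t1
    · exact absurd (by linear_combination h - h0) t1
    · exact h.2.2
  have c1 := (level_climb hev hinj hf (a + 1) (h0 ▸ hhub) h2 (k / 2 - 2) (by omega)).2
  have c2 := (level_climb hev hinj hf.neg (-a) (by simpa using hhub)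
    (by rw [neg_neg, ← h1]; congr 2; ring) (k / 2 - 2) (by omega)).2
  have hcast : ((k / 2 - 2 : ℕ) : ZMod k) + 2 = (k / 2 : ℕ) := by
    rw [Nat.cast_sub (by omega)]; simp
  have hhalf : ((k / 2 : ℕ) : ZMod k) + (k / 2 : ℕ) = 0 := by
    rw [← Nat.cast_add, show k / 2 + k / 2 = k by obtain ⟨h, rfl⟩ := hev; omega,
      ZMod.natCast_self]
  set s : ZMod k := ((k / 2 - 2 : ℕ) : ZMod k) with hs
  rw [show a + 1 + s + 1 = a + (k / 2 : ℕ) by linear_combination hcast, h0] at c1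
  rw [show -(-a + s + 1) = a + (k / 2 : ℕ) + 1 by linear_combination -hcast - hhalf,
    neg_neg] at c2
  have hnh : ¬ IsHub (level (f (a + (k / 2 : ℕ)))) := by
    have := not_isHub_add hev hhub (t := k / 2 - 2 + 1) (by omega) (by omega)
    rwa [Nat.cast_succ, ← add_assoc, ← hs, ← c1] at this
  rcases level_step hf (a + (k / 2 : ℕ)) with h | h | h
  · exact t1 (by linear_combination c2 - h - c1)
  · exact t1 (by linear_combination h + c1 - c2)
  · exact hnh h.2.2

theorem exists_inputs_of_even (hev : Even k)
    (hinj : Function.Injective fun v => (level v, idx v))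
    (hf : IsInducedCycle (gadget hk level idx x y) f) : ∃ i j, x i j ∧ y i j := by
  have : NeZero k := ⟨by omega⟩
  obtain ⟨t1, t2, -⟩ := one_two_three_ne_zero hk
  have hflat : ¬ ∀ a, level (f (a + 1)) = level (f a) + 0 := fun h =>
    not_plateau hf 0 (by simpa using h (0 - 1)) (by simpa using h 0)
  by_cases hdown : ∃ a, level (f (a + 1)) = level (f a) + -1
  · obtain ⟨a, ha⟩ := hdown
    -- Once the cycle descends it never rises again: a flat step is remembered together with the
    -- descent before it, so that a rise afterwards would be a trough.
    have hinv : ∀ n : ℕ, level (f (a + n + 1)) = level (f (a + n)) + -1 ∨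
        (level (f (a + n + 1)) = level (f (a + n)) ∧
          level (f (a + n - 1)) = level (f (a + n)) + 1) := by
      intro n
      induction n with
      | zero => left; simpa using ha
      | succ n ih =>
        rw [Nat.cast_succ, ← add_assoc]
        set b := a + (n : ZMod k)
        rw [add_sub_cancel_right]
        rcases ih with ih | ⟨ih1, ih2⟩
        · have e : level (f b) = level (f (b + 1)) + 1 := by rw [ih]; ring
          rcases level_step hf (b + 1) with h | h | h
          · exact (not_valley hev hinj hf (b + 1) (by rwa [add_sub_cancel_right]) h).elim
          · exact Or.inl h
          · exact Or.inr ⟨h.2.1, e⟩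
        · rcases level_step hf (b + 1) with h | h | h
          · exact (not_trough hev hinj hf b ih1 ih2 h).elim
          · exact Or.inl h
          · exact (not_plateau hf (b + 1) (by rwa [add_sub_cancel_right]) h.2.1).elim
    have hstep : ∀ b, level (f (b + 1)) = level (f b) + -1 ∨
        level (f (b + 1)) = level (f b) + 0 := fun b => by
      have h := hinv (b - a).val
      rw [ZMod.natCast_zmod_val, add_sub_cancel] at h
      rw [add_zero]
      exact h.imp_right fun h => h.1
    rcases forall_step_eq_of_isUnit_sub (c := fun a => level (f a))
      (by rw [sub_zero]; exact isUnit_one.neg) hstep with h | h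
    · exact exists_inputs_of_forall_down hf h
    · exact absurd h hflat
  · push Not at hdown
    have hstep : ∀ b, level (f (b + 1)) = level (f b) + 1 ∨
        level (f (b + 1)) = level (f b) + 0 := fun b => by
      rw [add_zero]
      rcases level_step hf b with h | h | h
      · exact Or.inl h
      · exact absurd h (hdown b)
      · exact Or.inr h.2.1
    rcases forall_step_eq_of_isUnit_sub (c := fun a => level (f a))
      (by rw [sub_zero]; exact isUnit_one) hstep with h | h
    · exact exists_inputs_of_forall_up hf h
    · exact absurd h hflat

end Even

/-- The gadget contains an induced `k`-cycle only if the two inputs intersect. -/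
theorem exists_inputs (hinj : Function.Injective fun v => (level v, idx v))
    (hf : IsInducedCycle (gadget hk level idx x y) f) : ∃ i j, x i j ∧ y i j := by
  by_cases hev : Even k
  · exact exists_inputs_of_even hev hinj hf
  · exact exists_inputs_of_odd hev hf

end

end InducedCycle

/-! ### The cut between the two inputs -/

namespace InducedCycle

section Cut

variable {V : Type} {k : ℕ} {hk : 4 ≤ k} {level : V → ZMod k} {idx : V → ℕ}
  {x x' y y' : ℕ → ℕ → Prop}

/-- The two levels between which the edges are given by the first input. -/
def aliceSide (level : V → ZMod k) : Set V := {v | level v = 0 ∨ level v = -1}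

theorem half_ne (hk : 4 ≤ k) : ((k / 2 : ℕ) : ZMod k) ≠ 0 ∧ ((k / 2 : ℕ) : ZMod k) ≠ -1 ∧
    ((k / 2 : ℕ) : ZMod k) ≠ 1 := by
  refine ⟨natCast_zmod_ne_zero (by omega) (by omega), fun h => ?_, fun h => ?_⟩
  · have := natCast_zmod_ne_zero (k := k) (n := k / 2 + 1) (by omega) (by omega)
    push_cast at this
    exact this (by rw [h]; ring)
  · have := natCast_zmod_ne_zero (k := k) (n := k / 2 - 1) (by omega) (by omega)
    rw [Nat.cast_sub (by omega), Nat.cast_one] at this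
    exact this (by rw [h]; ring)

theorem mem_aliceSide_of_up_zero {u v : V} (h : Up level idx x y u v) (hv : level v = 0) :
    u ∈ aliceSide level ∧ v ∈ aliceSide level :=
  ⟨Or.inr (by linear_combination hv - h.1), Or.inl hv⟩

theorem notMem_aliceSide_of_up_half (hk : 4 ≤ k) {u v : V} (h : Up level idx x y u v)
    (hv : level v = (k / 2 : ℕ)) : u ∉ aliceSide level ∧ v ∉ aliceSide level := by
  obtain ⟨h0, h1, h2⟩ := half_ne hk
  refine ⟨?_, ?_⟩ <;> rintro (h' | h')
  · exact h2 (by linear_combination h.1 - hv + h')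
  · exact h0 (by linear_combination h.1 - hv + h')
  · exact h0 (hv.symm.trans h')
  · exact h1 (hv.symm.trans h')

theorem Up.congr_right (hk : 4 ≤ k) {u v : V} (h : Up level idx x y u v)
    (huv : u ∈ aliceSide level ∨ v ∈ aliceSide level) : Up level idx x y' u v :=
  ⟨h.1, h.2.1, fun hv => absurd huv (by
    have := notMem_aliceSide_of_up_half hk h hv
    tauto), h.2.2.2⟩

theorem Up.congr_left {u v : V} (h : Up level idx x y u v)
    (huv : u ∉ aliceSide level ∨ v ∉ aliceSide level) : Up level idx x' y u v :=
  ⟨h.1, fun hv => absurd huv (by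
    have := mem_aliceSide_of_up_zero h hv
    tauto), h.2.2⟩

theorem gadget_adj_congr_right {v : V} (hv : v ∈ aliceSide level) (u : V) :
    (gadget hk level idx x y).Adj v u ↔ (gadget hk level idx x y').Adj v u :=
  or_congr ⟨fun h => h.congr_right hk (Or.inl hv), fun h => h.congr_right hk (Or.inl hv)⟩
    (or_congr_left ⟨fun h => h.congr_right hk (Or.inr hv), fun h => h.congr_right hk (Or.inr hv)⟩)

theorem gadget_adj_congr_left {v : V} (hv : v ∉ aliceSide level) (u : V) :
    (gadget hk level idx x y).Adj v u ↔ (gadget hk level idx x' y).Adj v u :=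
  or_congr ⟨fun h => h.congr_left (Or.inl hv), fun h => h.congr_left (Or.inl hv)⟩
    (or_congr_left ⟨fun h => h.congr_left (Or.inr hv), fun h => h.congr_left (Or.inr hv)⟩)

/-- Edges given by the inputs never cross the cut: those of `x` lie inside Alice's side and those of
`y` outside it. Only matching edges remain. -/
theorem Up.idx_eq_of_cut (hk : 4 ≤ k) {u v : V} (h : Up level idx x y u v)
    (huv : u ∈ aliceSide level ↔ v ∉ aliceSide level) : idx u = idx v := by
  refine h.2.2.2 ?_
  rintro (hv | hv)
  · have := mem_aliceSide_of_up_zero h hv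
    tauto
  · have := notMem_aliceSide_of_up_half hk h hv
    tauto

/-- The pairs of vertices of the same index on consecutive levels. -/
noncomputable def cutPairs [Fintype V] (level : V → ZMod k) (idx : V → ℕ) : Finset (V × V) :=
  open Classical in
  {e | idx e.1 = idx e.2 ∧ (level e.2 = level e.1 + 1 ∨ level e.1 = level e.2 + 1)}

variable [Fintype V]

theorem mem_cutPairs_of_adj {u v : V} (h : (gadget hk level idx x y).Adj v u)
    (huv : v ∈ aliceSide level ↔ u ∉ aliceSide level) : (v, u) ∈ cutPairs level idx := by
  classical
  simp only [cutPairs, Finset.mem_filter, Finset.mem_univ, true_and]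
  rcases h with h | h | h
  · exact ⟨h.idx_eq_of_cut hk huv, Or.inl h.1⟩
  · exact ⟨(h.idx_eq_of_cut hk (iff_not_comm.1 huv)).symm, Or.inr h.1⟩
  · have : v ∈ aliceSide level ↔ u ∈ aliceSide level := by
      simp only [aliceSide, Set.mem_ofPred_eq, h.2.2.1]
    tauto

/-- A pair is determined by its first vertex and whether the second one lies one level up or one
level down. -/
theorem card_cutPairs_le (hinj : Function.Injective fun v => (level v, idx v)) :
    (cutPairs level idx).card ≤ 2 * Fintype.card V := by
  classical
  have h := Finset.card_le_card_of_injOn (s := cutPairs level idx)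
    (t := (Finset.univ : Finset (V × Bool))) (fun e => (e.1, decide (level e.2 = level e.1 + 1)))
    (fun _ _ => Finset.mem_coe.2 (Finset.mem_univ _)) (by
      rintro ⟨u, v⟩ h ⟨u', v'⟩ h' heq
      simp only [cutPairs, Finset.coe_filter, Finset.mem_univ, true_and, Set.mem_ofPred_eq]
        at h h'
      simp only [Prod.mk.injEq, decide_eq_decide] at heq
      obtain ⟨rfl, heq⟩ := heq
      refine Prod.ext rfl (hinj (Prod.ext ?_ (h.1.symm.trans h'.1)))
      by_cases hv : level v = level u + 1
      · exact hv.trans (heq.1 hv).symm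
      · exact add_right_cancel ((h.2.resolve_left hv).symm.trans
          (h'.2.resolve_left (mt heq.2 hv))))
  simpa [mul_comm] using h

end Cut

end InducedCycle

/-! ### The reduction and the final count -/

namespace Congest

open InducedCycle SetDisjointness Finset

/-- The relation with characteristic function `x`. -/
def relOf {m : ℕ} (x : Fin m × Fin m → Bool) (i j : ℕ) : Prop :=
  ∃ a : Fin m × Fin m, a.1 = i ∧ a.2 = j ∧ x a = true

variable {k n : ℕ}

theorem level_idx_injective :
    Function.Injective fun v : Fin n => (((v : ℕ) : ZMod k), (v : ℕ) / k) := by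
  intro u v h
  simp only [Prod.mk.injEq] at h
  have h1 : (u : ℕ) % k = v % k := (ZMod.natCast_eq_natCast_iff' _ _ _).1 h.1
  refine Fin.ext ?_
  rw [← Nat.div_add_mod u k, ← Nat.div_add_mod v k, h1, h.2]

theorem exists_level_idx (hk : 0 < k) {i : ℕ} (hi : i < n / k) (ℓ : ZMod k) :
    ∃ v : Fin n, ((v : ℕ) : ZMod k) = ℓ ∧ (v : ℕ) / k = i := by
  have : NeZero k := ⟨hk.ne'⟩
  have hlt : k * i + ℓ.val < n := by
    have h1 := ℓ.val_lt
    have h2 : k * (i + 1) ≤ k * (n / k) := Nat.mul_le_mul_left k hi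
    have h3 := Nat.mul_div_le n k
    rw [mul_add] at h2
    omega
  refine ⟨⟨k * i + ℓ.val, hlt⟩, by simp, ?_⟩
  simp only
  rw [Nat.mul_add_div hk, Nat.div_eq_of_lt ℓ.val_lt, add_zero]

/-- The `n`-node network encoding two subsets of `Fin (n / k) × Fin (n / k)`. -/
def network (hk : 4 ≤ k) (n : ℕ) (x y : Fin (n / k) × Fin (n / k) → Bool) :
    SimpleGraph (Fin n) :=
  -- The `n % k` leftover vertices have index `n / k`, outside `Fin (n / k)`, so no input edge meets
  -- them.
  gadget hk (fun v => ((v : ℕ) : ZMod k)) (fun v => (v : ℕ) / k) (relOf x) (relOf y)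

theorem cycleGraph_isIndContained_network_iff (hk : 4 ≤ k)
    (x y : Fin (n / k) × Fin (n / k) → Bool) :
    (SimpleGraph.cycleGraph k).IsIndContained (network hk n x y) ↔
      ∃ a, x a = true ∧ y a = true := by
  rw [isIndContained_cycleGraph_iff hk]
  constructor
  · rintro ⟨f, hf⟩
    obtain ⟨i, j, ⟨a, rfl, rfl, ha⟩, ⟨a', h1, h2, ha'⟩⟩ :=
      exists_inputs level_idx_injective hf
    obtain rfl : a' = a := Prod.ext (Fin.ext h1) (Fin.ext h2)
    exact ⟨a', ha, ha'⟩
  · rintro ⟨a, ha, ha'⟩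
    exact exists_induced_cycle a.1 a.2 (exists_level_idx (by omega) a.1.2)
      (exists_level_idx (by omega) a.2.2) ⟨a, rfl, rfl, ha⟩ ⟨a, rfl, rfl, ha'⟩

theorem log_card_transcript_le {V : Type} (E : Finset (V × V)) (r w : ℕ) [DecidableEq E] :
    Real.log (Fintype.card ((Fin r → E → Message w) × Bool × Bool)) ≤ 2 * (r * E.card * w) + 3 := by
  have h1 : Fintype.card ((Fin r → E → Message w) × Bool × Bool) ≤ 3 ^ (r * E.card * w) * 4 := by
    simp only [Fintype.card_prod, Fintype.card_pi, Finset.prod_const, Finset.card_univ,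
      Fintype.card_fin, Fintype.card_bool, Fintype.card_coe]
    refine Nat.mul_le_mul ?_ (by norm_num)
    exact (Nat.pow_le_pow_left (Nat.pow_le_pow_left (card_message_le w) _) _).trans
      (le_of_eq (by ring))
  have h0 : 0 < Fintype.card ((Fin r → E → Message w) × Bool × Bool) :=
    Fintype.card_pos_iff.2 ⟨(fun _ _ => ⟨[], Nat.zero_le _⟩, false, false)⟩
  calc Real.log (Fintype.card ((Fin r → E → Message w) × Bool × Bool))
      ≤ Real.log ((3 : ℝ) ^ (r * E.card * w) * 4) :=
        Real.log_le_log (by exact_mod_cast h0) (by exact_mod_cast h1)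
    _ = r * E.card * w * Real.log 3 + Real.log 4 := by
        rw [Real.log_mul (by positivity) (by norm_num), Real.log_pow]
        push_cast
        rfl
    _ ≤ 2 * (r * E.card * w) + 3 := by
        have h3 : Real.log 3 ≤ 2 := by
          have := Real.log_le_sub_one_of_pos (show (0 : ℝ) < 3 by norm_num)
          linarith
        have h4 : Real.log 4 ≤ 3 := by
          have := Real.log_le_sub_one_of_pos (show (0 : ℝ) < 4 by norm_num)
          linarith
        have : (r * E.card * w : ℝ) * Real.log 3 ≤ r * E.card * w * 2 :=
          mul_le_mul_of_nonneg_left h3 (by positivity)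
        linarith

theorem sq_le_of_decides (hk : 4 ≤ k) {b w r : ℕ} (hb : n ≤ 2 ^ b) (A : Algorithm b w)
    (hA : A.Decides r n fun G => (SimpleGraph.cycleGraph k).IsIndContained G) :
    ((n / k : ℕ) : ℝ) ^ 2 ≤ 2304 * (n * r * w) + 1728 := by
  classical
  obtain ⟨ident⟩ : Nonempty (Fin n ↪ Ident b) :=
    Function.Embedding.nonempty_of_card_le (by simpa using hb)
  -- The instances are indexed by `D`, `j`, `z` and a bit `u` planted at `j` in both inputs; they
  -- intersect exactly when `u` is true.
  obtain ⟨ω, hω⟩ := exists_card_mul_le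
    (A.sharedLaw.prod (Measure.pi fun _ : Fin n => A.privateLaw))
    (fun q : (Fin (n / k) × Fin (n / k) → Bool) × (Fin (n / k) × Fin (n / k)) ×
      (Fin (n / k) × Fin (n / k) → Bool) × Bool =>
      {ω | ¬ (A.Accepts r (planted (network hk n) q.1 q.2.1 q.2.2.2 q.2.2.2 q.2.2.1) ident ω.1 ω.2 ↔
        (SimpleGraph.cycleGraph k).IsIndContained
          (planted (network hk n) q.1 q.2.1 q.2.2.2 q.2.2.2 q.2.2.1))})
    (fun q => hA _ ident)
  set E := cutPairs (fun v : Fin n => ((v : ℕ) : ZMod k)) (fun v => (v : ℕ) / k)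
  set Φ := fun x y => A.transcript ident ω.1 ω.2 r
    (aliceSide fun v : Fin n => ((v : ℕ) : ZMod k)) E (network hk n x y)
  have hrect : ∀ x y x' y', Φ x y = Φ x' y' → Φ x y' = Φ x y :=
    A.transcript_rectangle (G := network hk n)
      (fun v hv u x y y' => gadget_adj_congr_right hv u)
      (fun v hv u x x' y => gadget_adj_congr_left hv u)
      (fun v u x y h huv => mem_cutPairs_of_adj h huv)
  have hcontained : ∀ D j u z, (SimpleGraph.cycleGraph k).IsIndContained
      (planted (network hk n) D j u u z) ↔ u = true := by
    intro D j u z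
    rw [planted, cycleGraph_isIndContained_network_iff]
    constructor
    · rintro ⟨a, h1, h2⟩
      by_cases ha : a = j
      · subst ha
        simpa using h1
      · simp only [Function.update_of_ne ha, aliceInput, bobInput] at h1 h2
        cases D a <;> simp_all
    · rintro rfl
      exact ⟨j, by simp, by simp⟩
  have hacc : ∀ D j u z, A.Accepts r (planted (network hk n) D j u u z) ident ω.1 ω.2 ↔
      ((planted Φ D j u u z).2.1 = true ∨ (planted Φ D j u u z).2.2 = true) :=
    fun D j u z => A.accepts_iff_transcript ident ω.1 ω.2 r _ E _
  have key := card_le_log_card Φ hrect (fun τ => τ.2.1 = true ∨ τ.2.2 = true) (by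
    have h1 := hω
    simp only [Set.mem_ofPred_eq, hcontained, hacc] at h1
    rw [Nat.card_eq_fintype_card, Fintype.card_subtype, Finset.card_filter] at h1
    simp only [Fintype.sum_prod_type, Fintype.sum_bool] at h1
    push_cast [Finset.card_filter, Fintype.card_prod] at h1 ⊢
    simp only [Finset.sum_add_distrib] at h1 ⊢
    refine (le_of_eq ?_).trans (h1.trans (le_of_eq ?_))
    · rw [add_comm]
      simp only [Fintype.sum_prod_type, iff_true, iff_false, not_not]
    · simp
      ring)
  have hlog := log_card_transcript_le E r w
  have hEcard : (E.card : ℝ) ≤ 2 * n := by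
    have := card_cutPairs_le (level_idx_injective (n := n) (k := k))
    rw [Fintype.card_fin] at this
    exact_mod_cast this
  have hmul : (r * E.card * w : ℝ) ≤ r * (2 * n) * w := by gcongr
  simp only [Fintype.card_prod, Fintype.card_fin, Nat.cast_mul] at key hlog
  nlinarith

end Congest

theorem theorem1 (k : ℕ) (hk : 4 ≤ k) (C : ℝ) :
    ∃ c : ℝ, 0 < c ∧ ∃ N : ℕ, ∀ n : ℕ, N ≤ n →
      ∀ b w : ℕ, n ≤ 2 ^ b → (b : ℝ) ≤ C * Real.log n → (w : ℝ) ≤ C * Real.log n →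
        ∀ (A : Congest.Algorithm b w) (r : ℕ),
          A.Decides r n (fun G => (SimpleGraph.cycleGraph k).IsIndContained G) →
            c * (n / Real.log n) ≤ r := by
  set K : ℝ := max C 1 with hK
  have hK0 : 0 < K := lt_of_lt_of_le one_pos (le_max_right _ _)
  have hk0 : (0 : ℝ) < k := by exact_mod_cast (by omega : 0 < k)
  -- For `n ≥ 200 * k` one has `m ≥ 200`, so `1728 ≤ m ^ 2 / 2` is absorbed and `2304` doubles to
  -- `4608`; then `n ≤ 2 * k * m` contributes the factor `4 * k ^ 2`.
  refine ⟨1 / (18432 * k ^ 2 * K), by positivity, 200 * k, fun n hn b w hb _ hw A r hA => ?_⟩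
  have hn0 : (0 : ℝ) < n := by exact_mod_cast (by omega : 0 < n)
  have hlog : 0 < Real.log n := Real.log_pos (by exact_mod_cast (by omega : 1 < n))
  have hw' : (w : ℝ) ≤ K * Real.log n :=
    hw.trans (mul_le_mul_of_nonneg_right (le_max_left _ _) hlog.le)
  have hsq := Congest.sq_le_of_decides hk hb A hA
  have hm : 200 ≤ n / k := (Nat.le_div_iff_mul_le (by omega)).2 hn
  have hnm : (n : ℝ) ≤ 2 * k * (n / k : ℕ) := by
    have h1 := Nat.div_add_mod n k
    have h2 := Nat.mod_lt n (show 0 < k by omega)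
    have h3 : n ≤ k * (n / k) + k * (n / k) := by nlinarith
    have h4 : (n : ℝ) ≤ k * (n / k : ℕ) + k * (n / k : ℕ) := by exact_mod_cast h3
    linarith
  have hm' : (200 : ℝ) ≤ (n / k : ℕ) := by exact_mod_cast hm
  set m : ℝ := ((n / k : ℕ) : ℝ)
  have h1 : m ^ 2 ≤ 4608 * (n * r * w) := by nlinarith
  have h2 : (n : ℝ) * n ≤ n * (18432 * k ^ 2 * (r * w)) := by
    calc (n : ℝ) * n ≤ (2 * k * m) * (2 * k * m) := by gcongr
      _ = 4 * k ^ 2 * m ^ 2 := by ring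
      _ ≤ 4 * k ^ 2 * (4608 * (n * r * w)) := by gcongr
      _ = _ := by ring
  have h3 := le_of_mul_le_mul_left h2 hn0
  have h4 : (n : ℝ) ≤ 18432 * k ^ 2 * (r * (K * Real.log n)) := h3.trans (by gcongr)
  rw [one_div_mul_eq_div, div_div, div_le_iff₀ (by positivity)]
  linarith
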